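/- For $0<q<1$ put $(a;q)_n=\prod_{k=0}^{n-1}(1-aq^k)$, $(a;q)_\infty=\prod_{k\ge 0}(1-aq^k)$ and $\Gamma_q(x)=(1-q)^{1-x}\,(q;q)_\infty/(q^x;q)_\infty$; let $(a)_n=a(a+1)\cdots(a+n-1)$. Then for every real $q$ with $0<q<1$ the following three series converge absolutely and $$\sum_{n\geq 0} \frac{(-1)^n q^{n^2} (q^{2 n+1}-4 q^{4 n+1}+q^{6 n+1}+q^{8 n+2}+1) (q;q^2)_n^6}{(q^{2 n+1}+1) (q^2;q^2)_{2 n} (q^2;q^2)_n^4} = \frac{(1-q^2)^2}{\Gamma_{q^2}(1/2)^4},$$ $$\sum_{n\geq 0} \frac{(-1)^n q^{5 n^2} P_1(n) (q;q^2)_n^{10}}{(q^{2 n+1}+1)^5 (q^2;q^2)_{2 n}^5} = \frac{(1-q^2)^2}{\Gamma_{q^2}(1/2)^4},$$ $$\sum_{n\geq 0} \frac{q^{2 n^2} P_2(n) (q;q^2)_{2 n} (q;q^2)_n^6}{(q^{2 n+1}+1)^3 (q^2;q^2)_n^2 (q^2;q^2)_{2 n}^3} = \frac{(1-q^2)^2}{\Gamma_{q^2}(1/2)^4},$$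 where $P_1(n) = 5 q^{2 n+1}+10 q^{4 n+2}-5 q^{6 n+1}+10 q^{6 n+3}-15 q^{8 n+2}+5 q^{8 n+4}+q^{10 n+1}-24 q^{10 n+3}+q^{10 n+5}+5 q^{12 n+2}-15 q^{12 n+4}+10 q^{14 n+3}-5 q^{14 n+5}+10 q^{16 n+4}+5 q^{18 n+5}+q^{20 n+6}+1$ and $P_2(n) = 3 q^{2 n+1}-3 q^{4 n+1}+3 q^{4 n+2}-2 q^{6 n+1}-3 q^{6 n+2}+q^{6 n+3}+q^{8 n+1}-3 q^{8 n+2}-2 q^{8 n+3}+3 q^{10 n+2}-3 q^{10 n+3}+3 q^{12 n+3}+q^{14 n+4}+1$. These are respective $q$-analogues of the Ramanujan-type formulas $$\sum_{n\geq 0} \frac{(-1)^n}{2^{2n}} \frac{(\frac{1}{2})_n^5}{(1)_n^5} (20n^2+8n+1) = \frac{8}{\pi^2},\qquad \sum_{n\geq 0} \frac{(-1)^n}{2^{10n}} \frac{(\frac{1}{2})_n^5}{(1)_n^5} (820n^2+180n+13) = \frac{128}{\pi^2},$$ $$\sum_{n\geq 0} \Big(\frac{1}{2^4}\Big)^n \frac{(\frac{1}{2})_n^3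 (\frac{1}{4})_n (\frac{3}{4})_n}{(1)_n^5} (120n^2 + 34n+3) = \frac{32}{\pi^2}$$ (which are known and not part of the claim) in the following sense: after multiplying the three $q$-identities by $8/(1-q^2)^2$, $128/(1-q^2)^2$ and $32/(1-q^2)^2$ respectively, for each fixed $n\ge 0$ the $n$-th summand on the left converges, as $q\to 1^-$, to the $n$-th summand of the respective classical series, and the right-hand side converges to $8/\pi^2$, $128/\pi^2$ and $32/\pi^2$ respectively. -/

import Mathlib

open Filter Topology

noncomputable section

namespace QRamanujan

/-- The finite `q`-shifted factorial `(a; q)_n = ∏_{0 ≤ k < n} (1 - a q^k)`. -/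
def qPoch (a q : ℝ) (n : ℕ) : ℝ := ∏ k ∈ Finset.range n, (1 - a * q ^ k)

/-- The infinite `q`-shifted factorial `(a; q)_∞ = ∏_{k ≥ 0} (1 - a q^k)`
(the product converges for `|q| < 1`). -/
def qPochInf (a q : ℝ) : ℝ := ∏' k : ℕ, (1 - a * q ^ k)

/-- The `q`-gamma function `Γ_q(x) = (1 - q)^(1 - x) (q; q)_∞ / (q^x; q)_∞`, for `0 < q < 1`. -/
def qGamma (q x : ℝ) : ℝ := (1 - q) ^ (1 - x) * (qPochInf q q / qPochInf (q ^ x) q)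

/-- The classical shifted factorial `(a)_n = a (a + 1) ⋯ (a + n - 1)`. -/
def poch (a : ℝ) (n : ℕ) : ℝ := (ascPochhammer ℝ n).eval a

/-- The polynomial factor of the second `q`-series. -/
def P₁ (q : ℝ) (n : ℕ) : ℝ :=
  5 * q ^ (2 * n + 1) + 10 * q ^ (4 * n + 2) - 5 * q ^ (6 * n + 1) + 10 * q ^ (6 * n + 3)
    - 15 * q ^ (8 * n + 2) + 5 * q ^ (8 * n + 4) + q ^ (10 * n + 1) - 24 * q ^ (10 * n + 3)
    + q ^ (10 * n + 5) + 5 * q ^ (12 * n + 2) - 15 * q ^ (12 * n + 4) + 10 * q ^ (14 * n + 3)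
    - 5 * q ^ (14 * n + 5) + 10 * q ^ (16 * n + 4) + 5 * q ^ (18 * n + 5) + q ^ (20 * n + 6) + 1

/-- The polynomial factor of the third `q`-series. -/
def P₂ (q : ℝ) (n : ℕ) : ℝ :=
  3 * q ^ (2 * n + 1) - 3 * q ^ (4 * n + 1) + 3 * q ^ (4 * n + 2) - 2 * q ^ (6 * n + 1)
    - 3 * q ^ (6 * n + 2) + q ^ (6 * n + 3) + q ^ (8 * n + 1) - 3 * q ^ (8 * n + 2)
    - 2 * q ^ (8 * n + 3) + 3 * q ^ (10 * n + 2) - 3 * q ^ (10 * n + 3) + 3 * q ^ (12 * n + 3)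
    + q ^ (14 * n + 4) + 1

/-- The summand of the first `q`-series. -/
def S₁ (q : ℝ) (n : ℕ) : ℝ :=
  (-1) ^ n * q ^ (n ^ 2)
    * (q ^ (2 * n + 1) - 4 * q ^ (4 * n + 1) + q ^ (6 * n + 1) + q ^ (8 * n + 2) + 1)
    * qPoch q (q ^ 2) n ^ 6
    / ((q ^ (2 * n + 1) + 1) * qPoch (q ^ 2) (q ^ 2) (2 * n) * qPoch (q ^ 2) (q ^ 2) n ^ 4)

/-- The summand of the second `q`-series. -/
def S₂ (q : ℝ) (n : ℕ) : ℝ :=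
  (-1) ^ n * q ^ (5 * n ^ 2) * P₁ q n * qPoch q (q ^ 2) n ^ 10
    / ((q ^ (2 * n + 1) + 1) ^ 5 * qPoch (q ^ 2) (q ^ 2) (2 * n) ^ 5)

/-- The summand of the third `q`-series. -/
def S₃ (q : ℝ) (n : ℕ) : ℝ :=
  q ^ (2 * n ^ 2) * P₂ q n * qPoch q (q ^ 2) (2 * n) * qPoch q (q ^ 2) n ^ 6
    / ((q ^ (2 * n + 1) + 1) ^ 3 * qPoch (q ^ 2) (q ^ 2) n ^ 2
      * qPoch (q ^ 2) (q ^ 2) (2 * n) ^ 3)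

/-- The summand of the classical series with value `8 / π²`. -/
def R₁ (n : ℕ) : ℝ :=
  (-1) ^ n / 2 ^ (2 * n) * (poch (1 / 2) n ^ 5 / poch 1 n ^ 5) * (20 * (n : ℝ) ^ 2 + 8 * n + 1)

/-- The summand of the classical series with value `128 / π²`. -/
def R₂ (n : ℕ) : ℝ :=
  (-1) ^ n / 2 ^ (10 * n) * (poch (1 / 2) n ^ 5 / poch 1 n ^ 5)
    * (820 * (n : ℝ) ^ 2 + 180 * n + 13)

/-- The summand of the classical series with value `32 / π²`. -/
def R₃ (n : ℕ) : ℝ :=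
  (1 / 2 ^ 4) ^ n * (poch (1 / 2) n ^ 3 * poch (1 / 4) n * poch (3 / 4) n / poch 1 n ^ 5)
    * (120 * (n : ℝ) ^ 2 + 34 * n + 3)

end QRamanujan

end

/-!
If `F n k - F (n + 1) k = H n k - H n (k + 1)`, telescoping over a large rectangle evaluates
`∑ n, H n 0` as the limit of `H 0 k`, because `F 0 k` vanishes and everything else decays
geometrically. Two such pairs arise from the summand of the very-well-poised `q`-Dougall series in
base `q ^ 2`, and in both of them `H 0 k` tends to `((q; q²)_∞ / (q²; q²)_∞) ^ 4`, which is the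
common right-hand side.

For the first pair `H n 0` is `S₁`. The substitution `k ↦ k + n` produces a new pair with the same
limit, whose boundary series is `S₂`. The second pair has an additional parameter `m` and its first
component is symmetric in `n` and `m`, so that one can move along `m = n` by increasing `n` and `m`
alternately; the sum of the two steps is `S₃`.

As `q → 1`, the powers of `1 - q` in each summand cancel exactly and leave `q`-numbers, which are
polynomials in `q`. Finally `Γ_{q²}(1/2) ^ 2` equals `1 + q` times a `q`-analogue of the
Wallis product, whose factors are dominated by those at `q = 1`, so that it tends to `2 * (π / 2)`.
-/

noncomputable section

namespace QRamanujan

/-! ### Wilf–Zeilberger pairs -/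

theorem tendsto_const_mul_pow_add {r : ℝ} (hr0 : 0 ≤ r) (hr1 : r < 1) (A : ℝ) (n : ℕ) :
    Tendsto (fun k => A * r ^ (n + k)) atTop (𝓝 0) := by
  simpa only [pow_add, mul_zero] using
    ((tendsto_pow_atTop_nhds_zero_of_lt_one hr0 hr1).const_mul (r ^ n)).const_mul A

/-- A Wilf–Zeilberger pair: the discrete `1`-form with components `F` and `H` on the lattice
`ℕ × ℕ` is closed. The pair serves to evaluate the boundary series `∑ n, H n 0`. -/
def IsWZPair {E : Type*} [Sub E] (F H : ℕ → ℕ → E) : Prop :=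
  ∀ n k, F n k - F (n + 1) k = H n k - H n (k + 1)

namespace IsWZPair

section Algebra

variable {E : Type*} [AddCommGroup E] {F H : ℕ → ℕ → E}

theorem sum_range_sub_sum_range (h : IsWZPair F H) (N K : ℕ) :
    ∑ n ∈ Finset.range N, H n 0 - ∑ n ∈ Finset.range N, H n K
      = ∑ k ∈ Finset.range K, (F 0 k - F N k) := by
  calc ∑ n ∈ Finset.range N, H n 0 - ∑ n ∈ Finset.range N, H n K
      = ∑ n ∈ Finset.range N, ∑ k ∈ Finset.range K, (H n k - H n (k + 1)) := by
        rw [← Finset.sum_sub_distrib]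
        exact Finset.sum_congr rfl fun n _ => (Finset.sum_range_sub' (H n) K).symm
    _ = ∑ n ∈ Finset.range N, ∑ k ∈ Finset.range K, (F n k - F (n + 1) k) :=
        Finset.sum_congr rfl fun n _ => Finset.sum_congr rfl fun k _ => (h n k).symm
    _ = ∑ k ∈ Finset.range K, (F 0 k - F N k) := by
        rw [Finset.sum_comm]
        exact Finset.sum_congr rfl fun k _ => Finset.sum_range_sub' (fun n => F n k) N

theorem diagonal (h : IsWZPair F H) :
    IsWZPair (fun n k => F n (k + n)) fun n k => H n (k + n) + F (n + 1) (k + n) := by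
  intro n k
  have hstep : F n (k + n) = H n (k + n) - H n (k + n + 1) + F (n + 1) (k + n) :=
    sub_eq_iff_eq_add.1 (h n (k + n))
  simp only [← add_assoc, add_right_comm k 1 n, hstep]
  abel

-- The path `(n, n) → (n, n + 1) → (n + 1, n + 1)` crosses one row in each of the two symmetric
-- parameters, which gives the two terms of the second component.
theorem of_symm {F H : ℕ → ℕ → ℕ → E} (hsymm : ∀ n m k, F n m k = F m n k)
    (h : ∀ m, IsWZPair (fun n k => F n m k) fun n k => H n m k) :
    IsWZPair (fun n k => F n n k) fun n k => H n n k + H n (n + 1) k := by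
  intro n k
  calc F n n k - F (n + 1) (n + 1) k
      = (F n n k - F (n + 1) n k) + (F n (n + 1) k - F (n + 1) (n + 1) k) := by
        rw [hsymm (n + 1) n]
        abel
    _ = (H n n k - H n n (k + 1)) + (H n (n + 1) k - H n (n + 1) (k + 1)) :=
        congrArg₂ (· + ·) (h n n k) (h (n + 1) n k)
    _ = H n n k + H n (n + 1) k - (H n n (k + 1) + H n (n + 1) (k + 1)) := by abel

end Algebra

section Summation

variable {E : Type*} [NormedAddCommGroup E] {F H : ℕ → ℕ → E} {A B r : ℝ} {C : E}

theorem norm_sum_range_sub_le (h : IsWZPair F H) (hr0 : 0 ≤ r) (hr1 : r < 1)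
    (hF0 : ∀ k, F 0 k = 0) (hF : ∀ n k, n ≠ 0 → ‖F n k‖ ≤ A * r ^ (n + k))
    (hH0 : Tendsto (H 0) atTop (𝓝 C)) (hH : ∀ n k, n ≠ 0 → ‖H n k‖ ≤ B * r ^ (n + k)) (N : ℕ) :
    ‖∑ n ∈ Finset.range (N + 1), H n 0 - C‖ ≤ A * r ^ (N + 1) * (1 - r)⁻¹ := by
  have hA : 0 ≤ A * r ^ (N + 1) := by
    simpa using (norm_nonneg _).trans (hF (N + 1) 0 N.succ_ne_zero)
  have hcol : Tendsto (fun K => ∑ n ∈ Finset.range (N + 1), H n K) atTop (𝓝 C) := by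
    have hrows : Tendsto (fun K => ∑ n ∈ Finset.range N, H (n + 1) K) atTop (𝓝 0) := by
      simpa using tendsto_finsetSum (Finset.range N) fun n _ =>
        squeeze_zero_norm (hH (n + 1) · n.succ_ne_zero)
          (tendsto_const_mul_pow_add hr0 hr1 B (n + 1))
    simpa only [Finset.sum_range_succ', zero_add] using hrows.add hH0
  refine le_of_tendsto' (hcol.const_sub _).norm fun K => ?_
  rw [h.sum_range_sub_sum_range]
  calc ‖∑ k ∈ Finset.range K, (F 0 k - F (N + 1) k)‖
      ≤ ∑ k ∈ Finset.range K, A * r ^ (N + 1) * r ^ k := by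
        refine norm_sum_le_of_le _ fun k _ => ?_
        rw [hF0, zero_sub, norm_neg, mul_assoc, ← pow_add]
        exact hF (N + 1) k N.succ_ne_zero
    _ = A * r ^ (N + 1) * ∑ k ∈ Finset.range K, r ^ k := (Finset.mul_sum ..).symm
    _ ≤ A * r ^ (N + 1) * (1 - r)⁻¹ := by
        rw [← tsum_geometric_of_lt_one hr0 hr1]
        gcongr
        exact (summable_geometric_of_lt_one hr0 hr1).sum_le_tsum _ fun k _ => pow_nonneg hr0 k

theorem hasSum (h : IsWZPair F H) (hr0 : 0 ≤ r) (hr1 : r < 1)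
    (hF0 : ∀ k, F 0 k = 0) (hF : ∀ n k, n ≠ 0 → ‖F n k‖ ≤ A * r ^ (n + k))
    (hH0 : Tendsto (H 0) atTop (𝓝 C)) (hH : ∀ n k, n ≠ 0 → ‖H n k‖ ≤ B * r ^ (n + k)) :
    HasSum (fun n => H n 0) C := by
  have hgeom (M : ℝ) : Summable fun n => M * r ^ (n + 1) :=
    ((summable_nat_add_iff 1).2 (summable_geometric_of_lt_one hr0 hr1)).mul_left M
  have hsum : Summable fun n => ‖H n 0‖ := by
    rw [← summable_nat_add_iff 1]
    exact (hgeom B).of_nonneg_of_le (fun n => norm_nonneg _) fun n => hH (n + 1) 0 n.succ_ne_zero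
  rw [hasSum_iff_tendsto_nat_of_summable_norm hsum, ← tendsto_add_atTop_iff_nat 1,
    tendsto_iff_norm_sub_tendsto_zero]
  refine squeeze_zero (fun _ => norm_nonneg _)
    (h.norm_sum_range_sub_le hr0 hr1 hF0 hF hH0 hH) ?_
  simpa using (hgeom A).tendsto_atTop_zero.mul_const (1 - r)⁻¹

theorem hasSum_diagonal (h : IsWZPair F H) (hr0 : 0 ≤ r) (hr1 : r < 1)
    (hF0 : ∀ k, F 0 k = 0) (hF : ∀ n k, n ≠ 0 → ‖F n k‖ ≤ A * r ^ (n + k))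
    (hH0 : Tendsto (H 0) atTop (𝓝 C)) (hH : ∀ n k, n ≠ 0 → ‖H n k‖ ≤ B * r ^ (n + k)) :
    HasSum (fun n => H n n + F (n + 1) n) C := by
  have shift {G : ℕ → ℕ → E} {M : ℝ} (hG : ∀ n k, n ≠ 0 → ‖G n k‖ ≤ M * r ^ (n + k))
      (n k j : ℕ) (hn : n ≠ 0) : ‖G n (k + j)‖ ≤ M * r ^ (n + k) := by
    calc ‖G n (k + j)‖ ≤ M * r ^ (n + k) * r ^ j := by
          simpa only [pow_add, mul_assoc] using hG n (k + j) hn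
      _ ≤ M * r ^ (n + k) :=
          mul_le_of_le_one_right ((norm_nonneg _).trans (hG n k hn)) (pow_le_one₀ hr0 hr1.le)
  have hF1 : Tendsto (F 1) atTop (𝓝 0) :=
    squeeze_zero_norm (hF 1 · one_ne_zero) (tendsto_const_mul_pow_add hr0 hr1 A 1)
  have hdiag := h.diagonal.hasSum (A := A) (B := B + A * r) (C := C) hr0 hr1
    (fun k => hF0 (k + 0)) (fun n k hn => shift hF n k n hn)
    (by simpa using hH0.add hF1) fun n k hn => ?_
  · simpa only [zero_add] using hdiag
  calc ‖H n (k + n) + F (n + 1) (k + n)‖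
      ≤ B * r ^ (n + k) + A * r ^ (n + 1 + k) :=
        norm_add_le_of_le (shift hH n k n hn) (shift hF (n + 1) k n n.succ_ne_zero)
    _ = (B + A * r) * r ^ (n + k) := by ring

end Summation

end IsWZPair

/-! ### Shifted factorials -/

theorem qPoch_zero (a q : ℝ) : qPoch a q 0 = 1 :=
  Finset.prod_range_zero _

theorem qPoch_succ (a q : ℝ) (n : ℕ) : qPoch a q (n + 1) = qPoch a q n * (1 - a * q ^ n) :=
  Finset.prod_range_succ _ _

theorem tendsto_qPoch {q : ℝ} (hq0 : 0 ≤ q) (hq1 : q < 1) (a : ℝ) :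
    Tendsto (qPoch a q) atTop (𝓝 (qPochInf a q)) := by
  have hs : Summable fun k : ℕ => ‖-(a * q ^ k)‖ :=
    ((summable_geometric_of_lt_one hq0 hq1).mul_left a).neg.norm
  have hprod := (multipliable_one_add_of_summable hs).hasProd.tendsto_prod_nat
  simp only [← sub_eq_add_neg] at hprod
  exact hprod

section

variable {a q : ℝ}

theorem one_sub_mul_pow_pos (ha1 : a < 1) (hq0 : 0 ≤ q) (hq1 : q ≤ 1) (k : ℕ) :
    0 < 1 - a * q ^ k := by
  have hpow1 : q ^ k ≤ 1 := pow_le_one₀ hq0 hq1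
  rcases (pow_nonneg hq0 k).eq_or_lt with hpow0 | hpow0
  · simp [← hpow0]
  · nlinarith

theorem qPoch_pos (ha1 : a < 1) (hq0 : 0 ≤ q) (hq1 : q ≤ 1) (n : ℕ) : 0 < qPoch a q n :=
  Finset.prod_pos fun k _ => one_sub_mul_pow_pos ha1 hq0 hq1 k

theorem antitone_qPoch (ha0 : 0 ≤ a) (ha1 : a < 1) (hq0 : 0 ≤ q) (hq1 : q ≤ 1) :
    Antitone (qPoch a q) :=
  antitone_nat_of_succ_le fun n => by
    rw [qPoch_succ]
    exact mul_le_of_le_one_right (qPoch_pos ha1 hq0 hq1 n).le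
      (sub_le_self 1 (mul_nonneg ha0 (pow_nonneg hq0 n)))

theorem abs_qPoch_le_one (ha0 : 0 ≤ a) (ha1 : a < 1) (hq0 : 0 ≤ q) (hq1 : q ≤ 1) (n : ℕ) :
    |qPoch a q n| ≤ 1 := by
  rw [abs_of_pos (qPoch_pos ha1 hq0 hq1 n), ← qPoch_zero a q]
  exact antitone_qPoch ha0 ha1 hq0 hq1 n.zero_le

theorem qPochInf_le_qPoch (ha0 : 0 ≤ a) (ha1 : a < 1) (hq0 : 0 ≤ q) (hq1 : q < 1) (n : ℕ) :
    qPochInf a q ≤ qPoch a q n :=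
  (antitone_qPoch ha0 ha1 hq0 hq1.le).le_of_tendsto (tendsto_qPoch hq0 hq1 a) n

theorem qPochInf_pos (ha1 : a < 1) (hq0 : 0 ≤ q) (hq1 : q < 1) : 0 < qPochInf a q := by
  refine lt_of_le_of_ne
    (ge_of_tendsto' (tendsto_qPoch hq0 hq1 a) fun n => (qPoch_pos ha1 hq0 hq1.le n).le) (Ne.symm ?_)
  have hs : Summable fun k : ℕ => ‖-(a * q ^ k)‖ :=
    ((summable_geometric_of_lt_one hq0 hq1).mul_left a).neg.norm
  have hne (k : ℕ) : 1 + -(a * q ^ k) ≠ 0 := by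
    simpa only [← sub_eq_add_neg] using (one_sub_mul_pow_pos ha1 hq0 hq1.le k).ne'
  have hprod := tprod_one_add_ne_zero_of_summable hne hs
  simp only [← sub_eq_add_neg] at hprod
  exact hprod

end

section Ratios

variable {q : ℝ}

theorem one_sub_pow_ne_zero (hq0 : 0 ≤ q) (hq1 : q < 1) {e : ℕ} (he : e ≠ 0) : 1 - q ^ e ≠ 0 :=
  (sub_pos.2 (pow_lt_one₀ hq0 hq1 he)).ne'

theorem qPoch_sq_ne_zero (hq0 : 0 ≤ q) (hq1 : q < 1) (n : ℕ) : qPoch (q ^ 2) (q ^ 2) n ≠ 0 :=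
  (qPoch_pos (pow_lt_one₀ hq0 hq1 two_ne_zero) (sq_nonneg q) (pow_le_one₀ hq0 hq1.le) n).ne'

theorem qPoch_odd_succ (q : ℝ) (n : ℕ) :
    qPoch q (q ^ 2) (n + 1) = qPoch q (q ^ 2) n * (1 - q ^ (2 * n + 1)) := by
  rw [qPoch_succ]
  ring

theorem qPoch_even_succ (q : ℝ) (n : ℕ) :
    qPoch (q ^ 2) (q ^ 2) (n + 1) = qPoch (q ^ 2) (q ^ 2) n * (1 - q ^ (2 * n + 2)) := by
  rw [qPoch_succ]
  ring

end Ratios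

/-! ### The first seed -/

section FirstSeed

variable {q : ℝ}

/-- The `k`-th summand, in base `q ^ 2`, of the very-well-poised `q`-Dougall series with
`a = q ^ (2 * n + 1)` and all four numerator parameters equal to `q`, without its factor
`1 - q ^ (2 * n + 4 * k + 1)`. Its dependence on `n` is normalised so as to make `dougallF` and
`dougallH` a Wilf–Zeilberger pair. -/
def dougallWeight (q : ℝ) (n k : ℕ) : ℝ :=
  (-1) ^ n * q ^ (n ^ 2 + 4 * n * k) * (qPoch q (q ^ 2) n ^ 6 * qPoch q (q ^ 2) k ^ 4
    / (qPoch (q ^ 2) (q ^ 2) (n + k) ^ 4 * qPoch (q ^ 2) (q ^ 2) (2 * n)))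

/-- The first component of the Wilf–Zeilberger pair built on `dougallWeight`. -/
def dougallF (q : ℝ) (n k : ℕ) : ℝ :=
  dougallWeight q n k * ((1 - q ^ (2 * n + 4 * k + 1)) * (1 - q ^ (4 * n)))

/-- The second component of the Wilf–Zeilberger pair built on `dougallWeight`. -/
def dougallH (q : ℝ) (n k : ℕ) : ℝ :=
  dougallWeight q n k * (((1 - q ^ (4 * n + 2 * k + 1)) ^ 2
    + q ^ (2 * n + 1) * (1 - q ^ (2 * n + 2 * k)) ^ 2) / (1 + q ^ (2 * n + 1)))

theorem dougallWeight_succ_left (hq0 : 0 ≤ q) (hq1 : q < 1) (n k : ℕ) :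
    dougallWeight q (n + 1) k = -dougallWeight q n k
      * (q ^ (2 * n + 4 * k + 1) * (1 - q ^ (2 * n + 1)) ^ 6
        / ((1 - q ^ (2 * (n + k) + 2)) ^ 4 * (1 - q ^ (2 * (2 * n) + 2))
          * (1 - q ^ (2 * (2 * n + 1) + 2)))) := by
  have h₁ := one_sub_pow_ne_zero hq0 hq1 (e := 2 * (n + k) + 2) (by omega)
  have h₂ := one_sub_pow_ne_zero hq0 hq1 (e := 2 * (2 * n) + 2) (by omega)
  have h₃ := one_sub_pow_ne_zero hq0 hq1 (e := 2 * (2 * n + 1) + 2) (by omega)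
  have hv₁ := qPoch_sq_ne_zero hq0 hq1 (n + k)
  have hv₂ := qPoch_sq_ne_zero hq0 hq1 (2 * n)
  unfold dougallWeight
  rw [show 2 * (n + 1) = 2 * n + 1 + 1 by ring, add_right_comm n 1 k]
  simp only [qPoch_odd_succ, qPoch_even_succ]
  generalize 1 - q ^ (2 * (n + k) + 2) = d₁ at *
  generalize 1 - q ^ (2 * (2 * n) + 2) = d₂ at *
  generalize 1 - q ^ (2 * (2 * n + 1) + 2) = d₃ at *
  field_simp
  ring

theorem dougallWeight_succ_right (hq0 : 0 ≤ q) (hq1 : q < 1) (n k : ℕ) :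
    dougallWeight q n (k + 1) = dougallWeight q n k
      * (q ^ (4 * n) * (1 - q ^ (2 * k + 1)) ^ 4 / (1 - q ^ (2 * n + 2 * k + 2)) ^ 4) := by
  have := qPoch_sq_ne_zero hq0 hq1 (n + k)
  have := one_sub_pow_ne_zero hq0 hq1 (e := 2 * (n + k) + 2) (by omega)
  unfold dougallWeight
  rw [← add_assoc n k 1, show 2 * n + 2 * k + 2 = 2 * (n + k) + 2 by ring]
  simp only [qPoch_odd_succ, qPoch_even_succ]
  field_simp
  ring

theorem dougall_certificate {K : Type*} [Field K] {q x y : K} (h₁ : 1 - q ^ 2 * x * y ≠ 0)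
    (h₂ : 1 - q ^ 2 * x ^ 2 ≠ 0) (h₃ : 1 - q ^ 4 * x ^ 2 ≠ 0) (h₄ : 1 + q * x ≠ 0) :
    (1 - q * x * y ^ 2) * (1 - x ^ 2)
        + q * x * y ^ 2 * (1 - q * x) ^ 6
            / ((1 - q ^ 2 * x * y) ^ 4 * (1 - q ^ 2 * x ^ 2) * (1 - q ^ 4 * x ^ 2))
          * ((1 - q ^ 3 * x * y ^ 2) * (1 - q ^ 4 * x ^ 2))
      = ((1 - q * x ^ 2 * y) ^ 2 + q * x * (1 - x * y) ^ 2) / (1 + q * x)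
        - x ^ 2 * (1 - q * y) ^ 4 / (1 - q ^ 2 * x * y) ^ 4
          * (((1 - q ^ 3 * x ^ 2 * y) ^ 2 + q * x * (1 - q ^ 2 * x * y) ^ 2) / (1 + q * x)) := by
  field_simp
  ring

theorem isWZPair_dougall (hq0 : 0 ≤ q) (hq1 : q < 1) : IsWZPair (dougallF q) (dougallH q) := by
  intro n k
  have h₁ : 1 - q ^ 2 * q ^ (2 * n) * q ^ (2 * k) ≠ 0 := by
    rw [← pow_add, ← pow_add]
    exact one_sub_pow_ne_zero hq0 hq1 (by omega)
  have h₂ : 1 - q ^ 2 * (q ^ (2 * n)) ^ 2 ≠ 0 := by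
    rw [← pow_mul, ← pow_add]
    exact one_sub_pow_ne_zero hq0 hq1 (by omega)
  have h₃ : 1 - q ^ 4 * (q ^ (2 * n)) ^ 2 ≠ 0 := by
    rw [← pow_mul, ← pow_add]
    exact one_sub_pow_ne_zero hq0 hq1 (by omega)
  have h₄ : 1 + q * q ^ (2 * n) ≠ 0 := by positivity
  unfold dougallF dougallH
  rw [dougallWeight_succ_left hq0 hq1, dougallWeight_succ_right hq0 hq1]
  linear_combination dougallWeight q n k * dougall_certificate h₁ h₂ h₃ h₄

theorem abs_one_sub_pow_le_one (hq0 : 0 ≤ q) (hq1 : q ≤ 1) (e : ℕ) : |1 - q ^ e| ≤ 1 :=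
  abs_le.2 ⟨by linarith [pow_le_one₀ (n := e) hq0 hq1], by linarith [pow_nonneg hq0 e]⟩

theorem abs_dougallWeight_le (hq0 : 0 ≤ q) (hq1 : q < 1) {n : ℕ} (k : ℕ) (hn : n ≠ 0) :
    |dougallWeight q n k| ≤ (qPochInf (q ^ 2) (q ^ 2) ^ 5)⁻¹ * q ^ (n + k) := by
  have hp0 := sq_nonneg q
  have hp1 : q ^ 2 < 1 := pow_lt_one₀ hq0 hq1 two_ne_zero
  have hV := qPochInf_pos hp1 hp0 hp1
  have hu := abs_qPoch_le_one hq0 hq1 hp0 hp1.le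
  have hv (j : ℕ) := (qPochInf_le_qPoch hp0 hp1 hp0 hp1 j).trans (le_abs_self _)
  have hn1 : 1 ≤ n := Nat.one_le_iff_ne_zero.2 hn
  have hexp : n + k ≤ n ^ 2 + 4 * n * k := by nlinarith [Nat.mul_le_mul_right k hn1]
  set V := qPochInf (q ^ 2) (q ^ 2)
  calc |dougallWeight q n k|
      ≤ q ^ (n + k) * (1 ^ 6 * 1 ^ 4 / (V ^ 4 * V)) := by
        rw [dougallWeight, mul_assoc, abs_mul, abs_neg_one_pow, one_mul]
        simp only [abs_mul, abs_div, abs_pow, abs_of_nonneg hq0]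
        gcongr ?_ * (?_ ^ 6 * ?_ ^ 4 / (?_ ^ 4 * ?_))
        · exact pow_le_pow_of_le_one hq0 hq1.le hexp
        all_goals first | exact hu _ | exact hv _
    _ = (V ^ 5)⁻¹ * q ^ (n + k) := by ring

theorem dougallF_zero_left (q : ℝ) (k : ℕ) : dougallF q 0 k = 0 := by
  simp [dougallF]

theorem abs_dougallF_le (hq0 : 0 ≤ q) (hq1 : q ≤ 1) (n k : ℕ) :
    |dougallF q n k| ≤ |dougallWeight q n k| := by
  rw [dougallF, abs_mul, abs_mul]
  have h := abs_one_sub_pow_le_one hq0 hq1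
  exact mul_le_of_le_one_right (abs_nonneg _) (mul_le_one₀ (h _) (abs_nonneg _) (h _))

theorem abs_dougallH_le (hq0 : 0 ≤ q) (hq1 : q ≤ 1) (n k : ℕ) :
    |dougallH q n k| ≤ |dougallWeight q n k| := by
  rw [dougallH, abs_mul]
  refine mul_le_of_le_one_right (abs_nonneg _) ?_
  have h (e : ℕ) : (1 - q ^ e) ^ 2 ≤ 1 := (sq_le_one_iff_abs_le_one _).2
    (abs_one_sub_pow_le_one hq0 hq1 e)
  rw [abs_of_nonneg (by positivity)]
  refine div_le_one_of_le₀ (add_le_add (h _) (mul_le_of_le_one_right (by positivity) (h _)))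
    (by positivity)

theorem tendsto_dougallH_zero (hq0 : 0 ≤ q) (hq1 : q < 1) :
    Tendsto (dougallH q 0) atTop (𝓝 ((qPochInf q (q ^ 2) / qPochInf (q ^ 2) (q ^ 2)) ^ 4)) := by
  have hp0 := sq_nonneg q
  have hp1 : q ^ 2 < 1 := pow_lt_one₀ hq0 hq1 two_ne_zero
  have hpow (j : ℕ) : Tendsto (fun k => q ^ (2 * k + j)) atTop (𝓝 0) :=
    (tendsto_pow_atTop_nhds_zero_of_lt_one hq0 hq1).comp
      (tendsto_atTop_mono (fun k => show k ≤ 2 * k + j by omega) tendsto_id)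
  have hweight := ((tendsto_qPoch hp0 hp1 q).div (tendsto_qPoch hp0 hp1 (q ^ 2))
    (qPochInf_pos hp1 hp0 hp1).ne').pow 4
  have hfactor := ((((hpow 1).const_sub 1).pow 2).add
    ((((hpow 0).const_sub 1).pow 2).const_mul q)).div_const (1 + q)
  have hq : 1 + q ≠ 0 := by positivity
  convert! hweight.mul hfactor using 2 with k
  · simp [dougallH, dougallWeight, qPoch_zero, div_pow]
  · field_simp
    ring

theorem S₁_polynomial_eq (q : ℝ) (n : ℕ) :
    q ^ (2 * n + 1) - 4 * q ^ (4 * n + 1) + q ^ (6 * n + 1) + q ^ (8 * n + 2) + 1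
      = (1 - q ^ (4 * n + 1)) ^ 2 + q ^ (2 * n + 1) * (1 - q ^ (2 * n)) ^ 2 := by
  ring

theorem dougallH_zero_right (q : ℝ) (n : ℕ) : dougallH q n 0 = S₁ q n := by
  rw [S₁, S₁_polynomial_eq]
  simp only [dougallH, dougallWeight, qPoch_zero, mul_zero, add_zero, div_eq_mul_inv, mul_inv]
  ring

theorem P₁_eq (q : ℝ) (n : ℕ) :
    P₁ q n = (1 + q ^ (2 * n + 1)) ^ 4
        * ((1 - q ^ (6 * n + 1)) ^ 2 + q ^ (2 * n + 1) * (1 - q ^ (4 * n)) ^ 2)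
      - q ^ (6 * n + 1) * (1 - q ^ (2 * n + 1)) * (1 - q ^ (6 * n + 3)) := by
  unfold P₁
  ring

theorem dougallF_succ_self (hq0 : 0 ≤ q) (hq1 : q < 1) (n : ℕ) :
    dougallF q (n + 1) n = -dougallWeight q n n
      * (q ^ (6 * n + 1) * (1 - q ^ (2 * n + 1)) * (1 - q ^ (6 * n + 3))
        / (1 + q ^ (2 * n + 1)) ^ 5) := by
  have h₁ : 1 - q ^ (2 * n + 1) ≠ 0 := one_sub_pow_ne_zero hq0 hq1 (by omega)
  have h₂ : 1 + q ^ (2 * n + 1) ≠ 0 := by positivity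
  have h₃ : 1 - q ^ (4 * n + 4) ≠ 0 := one_sub_pow_ne_zero hq0 hq1 (by omega)
  have hsq : 1 - q ^ (4 * n + 2) = (1 - q ^ (2 * n + 1)) * (1 + q ^ (2 * n + 1)) := by ring
  rw [dougallF, dougallWeight_succ_left hq0 hq1, show 2 * (n + n) + 2 = 4 * n + 2 by ring,
    show 2 * (2 * n) + 2 = 4 * n + 2 by ring, show 2 * (2 * n + 1) + 2 = 4 * n + 4 by ring, hsq]
  generalize 1 - q ^ (2 * n + 1) = a at *
  generalize 1 + q ^ (2 * n + 1) = b at *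
  rw [show 4 * (n + 1) = 4 * n + 4 by ring, show 2 * (n + 1) + 4 * n + 1 = 6 * n + 3 by ring]
  generalize 1 - q ^ (4 * n + 4) = c at *
  field_simp
  ring

theorem dougallH_self_add_dougallF_succ_self (hq0 : 0 ≤ q) (hq1 : q < 1) (n : ℕ) :
    dougallH q n n + dougallF q (n + 1) n = S₂ q n := by
  have h : 1 + q ^ (2 * n + 1) ≠ 0 := by positivity
  have hv := qPoch_sq_ne_zero hq0 hq1 (2 * n)
  rw [S₂, P₁_eq, dougallF_succ_self hq0 hq1, dougallH, dougallWeight, ← two_mul n,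
    show 4 * n + 2 * n + 1 = 6 * n + 1 by ring, show 2 * n + 2 * n = 4 * n by ring,
    show n ^ 2 + 4 * n * n = 5 * n ^ 2 by ring, add_comm _ (1 : ℝ)]
  field_simp
  ring

theorem hasSum_S₁ (hq0 : 0 ≤ q) (hq1 : q < 1) :
    HasSum (S₁ q) ((qPochInf q (q ^ 2) / qPochInf (q ^ 2) (q ^ 2)) ^ 4) := by
  simpa only [dougallH_zero_right] using
    (isWZPair_dougall hq0 hq1).hasSum hq0 hq1 (dougallF_zero_left q)
      (fun n k hn => (abs_dougallF_le hq0 hq1.le n k).trans (abs_dougallWeight_le hq0 hq1 k hn))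
      (tendsto_dougallH_zero hq0 hq1)
      fun n k hn => (abs_dougallH_le hq0 hq1.le n k).trans (abs_dougallWeight_le hq0 hq1 k hn)

theorem hasSum_S₂ (hq0 : 0 ≤ q) (hq1 : q < 1) :
    HasSum (S₂ q) ((qPochInf q (q ^ 2) / qPochInf (q ^ 2) (q ^ 2)) ^ 4) := by
  simpa only [dougallH_self_add_dougallF_succ_self hq0 hq1] using
    (isWZPair_dougall hq0 hq1).hasSum_diagonal hq0 hq1 (dougallF_zero_left q)
      (fun n k hn => (abs_dougallF_le hq0 hq1.le n k).trans (abs_dougallWeight_le hq0 hq1 k hn))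
      (tendsto_dougallH_zero hq0 hq1)
      fun n k hn => (abs_dougallH_le hq0 hq1.le n k).trans (abs_dougallWeight_le hq0 hq1 k hn)

end FirstSeed

/-! ### The second seed -/

section SecondSeed

variable {q : ℝ}

/-- The `k`-th summand, in base `q ^ 2`, of the very-well-poised `q`-Dougall series with
`a = q ^ (2 * n + 2 * m + 1)` and numerator parameters `q`, `q`, `q ^ (2 * n + 1)`,
`q ^ (2 * m + 1)`, without its factor `1 - q ^ (2 * n + 2 * m + 4 * k + 1)`. Its dependence on `n`
and `m` is normalised so as to make `symmF` and `symmH` a Wilf–Zeilberger pair in `n` and `k`, and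
symmetric in `n` and `m`. -/
def symmWeight (q : ℝ) (n m k : ℕ) : ℝ :=
  q ^ (2 * n * m + 2 * (n + m) * k)
    * (qPoch q (q ^ 2) n ^ 2 * qPoch q (q ^ 2) m ^ 2 * qPoch q (q ^ 2) (n + m)
      * qPoch q (q ^ 2) (n + k) * qPoch q (q ^ 2) (m + k) * qPoch q (q ^ 2) k ^ 2
      / (qPoch (q ^ 2) (q ^ 2) (n + k) * qPoch (q ^ 2) (q ^ 2) (m + k)
        * qPoch (q ^ 2) (q ^ 2) (n + m + k) ^ 2 * qPoch (q ^ 2) (q ^ 2) (n + m)))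

/-- The first component of the Wilf–Zeilberger pair built on `symmWeight`. -/
def symmF (q : ℝ) (n m k : ℕ) : ℝ :=
  symmWeight q n m k * ((1 - q ^ (2 * n + 2 * m + 4 * k + 1)) * (1 - q ^ (2 * n + 2 * m)))

/-- The second component of the Wilf–Zeilberger pair built on `symmWeight`. -/
def symmH (q : ℝ) (n m k : ℕ) : ℝ :=
  symmWeight q n m k * ((1 - q ^ (2 * m + 2 * k)) * (1 - q ^ (4 * n + 2 * m + 2 * k + 1)))

theorem symmWeight_comm (q : ℝ) (n m k : ℕ) : symmWeight q n m k = symmWeight q m n k := by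
  rw [symmWeight, symmWeight, add_comm n m, mul_right_comm 2 n m]
  ring

theorem symmF_comm (q : ℝ) (n m k : ℕ) : symmF q n m k = symmF q m n k := by
  rw [symmF, symmF, symmWeight_comm, add_comm (2 * n)]

theorem symmWeight_succ_left (hq0 : 0 ≤ q) (hq1 : q < 1) (n m k : ℕ) :
    symmWeight q (n + 1) m k = symmWeight q n m k
      * (q ^ (2 * m + 2 * k) * ((1 - q ^ (2 * n + 1)) ^ 2 * (1 - q ^ (2 * (n + m) + 1))
          * (1 - q ^ (2 * (n + k) + 1)))
        / ((1 - q ^ (2 * (n + k) + 2)) * (1 - q ^ (2 * (n + m + k) + 2)) ^ 2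
          * (1 - q ^ (2 * (n + m) + 2)))) := by
  have h₁ := one_sub_pow_ne_zero hq0 hq1 (e := 2 * (n + k) + 2) (by omega)
  have h₂ := one_sub_pow_ne_zero hq0 hq1 (e := 2 * (n + m + k) + 2) (by omega)
  have h₃ := one_sub_pow_ne_zero hq0 hq1 (e := 2 * (n + m) + 2) (by omega)
  have hv := qPoch_sq_ne_zero hq0 hq1
  have hv₁ := hv (n + k)
  have hv₂ := hv (m + k)
  have hv₃ := hv (n + m + k)
  have hv₄ := hv (n + m)
  unfold symmWeight
  rw [add_right_comm n 1 m, add_right_comm n 1 k, add_right_comm (n + m) 1 k]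
  simp only [qPoch_odd_succ, qPoch_even_succ]
  generalize 1 - q ^ (2 * (n + k) + 2) = d₁ at *
  generalize 1 - q ^ (2 * (n + m + k) + 2) = d₂ at *
  generalize 1 - q ^ (2 * (n + m) + 2) = d₃ at *
  field_simp
  ring

theorem symmWeight_succ_right (hq0 : 0 ≤ q) (hq1 : q < 1) (n m k : ℕ) :
    symmWeight q n m (k + 1) = symmWeight q n m k
      * (q ^ (2 * n + 2 * m) * ((1 - q ^ (2 * (n + k) + 1)) * (1 - q ^ (2 * (m + k) + 1))
          * (1 - q ^ (2 * k + 1)) ^ 2)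
        / ((1 - q ^ (2 * (n + k) + 2)) * (1 - q ^ (2 * (m + k) + 2))
          * (1 - q ^ (2 * (n + m + k) + 2)) ^ 2)) := by
  have h₁ := one_sub_pow_ne_zero hq0 hq1 (e := 2 * (n + k) + 2) (by omega)
  have h₂ := one_sub_pow_ne_zero hq0 hq1 (e := 2 * (m + k) + 2) (by omega)
  have h₃ := one_sub_pow_ne_zero hq0 hq1 (e := 2 * (n + m + k) + 2) (by omega)
  have hv := qPoch_sq_ne_zero hq0 hq1
  have hv₁ := hv (n + k)
  have hv₂ := hv (m + k)
  have hv₃ := hv (n + m + k)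
  have hv₄ := hv (n + m)
  unfold symmWeight
  simp only [← add_assoc, qPoch_odd_succ, qPoch_even_succ]
  generalize 1 - q ^ (2 * (n + k) + 2) = d₁ at *
  generalize 1 - q ^ (2 * (m + k) + 2) = d₂ at *
  generalize 1 - q ^ (2 * (n + m + k) + 2) = d₃ at *
  field_simp
  ring

theorem symm_certificate {K : Type*} [Field K] {q x y z : K} (h₁ : 1 - q ^ 2 * x * y ≠ 0)
    (h₂ : 1 - q ^ 2 * z * y ≠ 0) (h₃ : 1 - q ^ 2 * x * z * y ≠ 0) (h₄ : 1 - q ^ 2 * x * z ≠ 0) :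
    (1 - q * x * z * y ^ 2) * (1 - x * z)
        - z * y * ((1 - q * x) ^ 2 * (1 - q * x * z) * (1 - q * x * y))
            / ((1 - q ^ 2 * x * y) * (1 - q ^ 2 * x * z * y) ^ 2 * (1 - q ^ 2 * x * z))
          * ((1 - q ^ 3 * x * z * y ^ 2) * (1 - q ^ 2 * x * z))
      = (1 - z * y) * (1 - q * x ^ 2 * z * y)
        - x * z * ((1 - q * x * y) * (1 - q * z * y) * (1 - q * y) ^ 2)
            / ((1 - q ^ 2 * x * y) * (1 - q ^ 2 * z * y) * (1 - q ^ 2 * x * z * y) ^ 2)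
          * ((1 - q ^ 2 * z * y) * (1 - q ^ 3 * x ^ 2 * z * y)) := by
  field_simp
  ring

theorem isWZPair_symm (hq0 : 0 ≤ q) (hq1 : q < 1) (m : ℕ) :
    IsWZPair (fun n k => symmF q n m k) fun n k => symmH q n m k := by
  intro n k
  have h₁ : 1 - q ^ 2 * q ^ (2 * n) * q ^ (2 * k) ≠ 0 := by
    simp only [← pow_add]
    exact one_sub_pow_ne_zero hq0 hq1 (by omega)
  have h₂ : 1 - q ^ 2 * q ^ (2 * m) * q ^ (2 * k) ≠ 0 := by
    simp only [← pow_add]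
    exact one_sub_pow_ne_zero hq0 hq1 (by omega)
  have h₃ : 1 - q ^ 2 * q ^ (2 * n) * q ^ (2 * m) * q ^ (2 * k) ≠ 0 := by
    simp only [← pow_add]
    exact one_sub_pow_ne_zero hq0 hq1 (by omega)
  have h₄ : 1 - q ^ 2 * q ^ (2 * n) * q ^ (2 * m) ≠ 0 := by
    simp only [← pow_add]
    exact one_sub_pow_ne_zero hq0 hq1 (by omega)
  simp only [symmF, symmH]
  rw [symmWeight_succ_left hq0 hq1, symmWeight_succ_right hq0 hq1]
  linear_combination symmWeight q n m k * symm_certificate h₁ h₂ h₃ h₄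

theorem abs_symmWeight_le (hq0 : 0 ≤ q) (hq1 : q < 1) {m : ℕ} (n k : ℕ) (hm : m ≠ 0) :
    |symmWeight q n m k| ≤ (qPochInf (q ^ 2) (q ^ 2) ^ 5)⁻¹ * q ^ (n + k) := by
  have hp0 := sq_nonneg q
  have hp1 : q ^ 2 < 1 := pow_lt_one₀ hq0 hq1 two_ne_zero
  have hV := qPochInf_pos hp1 hp0 hp1
  have hu := abs_qPoch_le_one hq0 hq1 hp0 hp1.le
  have hv (j : ℕ) := (qPochInf_le_qPoch hp0 hp1 hp0 hp1 j).trans (le_abs_self _)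
  have hm1 : 1 ≤ m := Nat.one_le_iff_ne_zero.2 hm
  have hexp : n + k ≤ 2 * n * m + 2 * (n + m) * k := by
    nlinarith [Nat.mul_le_mul_left n hm1, Nat.mul_le_mul_right k hm1]
  set V := qPochInf (q ^ 2) (q ^ 2)
  calc |symmWeight q n m k|
      ≤ q ^ (n + k) * (1 ^ 2 * 1 ^ 2 * 1 * 1 * 1 * 1 ^ 2 / (V * V * V ^ 2 * V)) := by
        simp only [symmWeight, abs_mul, abs_div, abs_pow, abs_of_nonneg hq0]
        gcongr ?_ * (?_ ^ 2 * ?_ ^ 2 * ?_ * ?_ * ?_ * ?_ ^ 2 / (?_ * ?_ * ?_ ^ 2 * ?_))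
        · exact pow_le_pow_of_le_one hq0 hq1.le hexp
        all_goals first | exact hu _ | exact hv _
    _ = (V ^ 5)⁻¹ * q ^ (n + k) := by ring

theorem abs_symmF_le (hq0 : 0 ≤ q) (hq1 : q ≤ 1) (n m k : ℕ) :
    |symmF q n m k| ≤ |symmWeight q n m k| := by
  rw [symmF, abs_mul, abs_mul]
  have h := abs_one_sub_pow_le_one hq0 hq1
  exact mul_le_of_le_one_right (abs_nonneg _) (mul_le_one₀ (h _) (abs_nonneg _) (h _))

theorem abs_symmH_le (hq0 : 0 ≤ q) (hq1 : q ≤ 1) (n m k : ℕ) :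
    |symmH q n m k| ≤ |symmWeight q n m k| := by
  rw [symmH, abs_mul, abs_mul]
  have h := abs_one_sub_pow_le_one hq0 hq1
  exact mul_le_of_le_one_right (abs_nonneg _) (mul_le_one₀ (h _) (abs_nonneg _) (h _))

theorem tendsto_symmH_zero_zero (hq0 : 0 ≤ q) (hq1 : q < 1) :
    Tendsto (symmH q 0 0) atTop (𝓝 ((qPochInf q (q ^ 2) / qPochInf (q ^ 2) (q ^ 2)) ^ 4)) := by
  have hp0 := sq_nonneg q
  have hp1 : q ^ 2 < 1 := pow_lt_one₀ hq0 hq1 two_ne_zero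
  have hpow (j : ℕ) : Tendsto (fun k => q ^ (2 * k + j)) atTop (𝓝 0) :=
    (tendsto_pow_atTop_nhds_zero_of_lt_one hq0 hq1).comp
      (tendsto_atTop_mono (fun k => show k ≤ 2 * k + j by omega) tendsto_id)
  have hweight := ((tendsto_qPoch hp0 hp1 q).div (tendsto_qPoch hp0 hp1 (q ^ 2))
    (qPochInf_pos hp1 hp0 hp1).ne').pow 4
  have hfactor := ((hpow 0).const_sub 1).mul ((hpow 1).const_sub 1)
  convert! hweight.mul hfactor using 2 with k
  · simp only [symmH, symmWeight, Pi.div_apply, qPoch_zero, mul_zero, add_zero, zero_add, zero_mul]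
    ring
  · ring

theorem symmF_zero_zero (q : ℝ) (k : ℕ) : symmF q 0 0 k = 0 := by
  simp [symmF]

theorem P₂_eq (q : ℝ) (n : ℕ) :
    P₂ q n = (1 + q ^ (2 * n + 1)) ^ 3 * ((1 - q ^ (2 * n)) * (1 - q ^ (6 * n + 1)))
      + q ^ (2 * n) * (1 - q ^ (4 * n + 1)) * (1 - q ^ (6 * n + 3)) := by
  unfold P₂
  ring

theorem symmH_self_succ_zero (hq0 : 0 ≤ q) (hq1 : q < 1) (n : ℕ) :
    symmH q n (n + 1) 0 = symmWeight q n n 0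
      * (q ^ (2 * n) * (1 - q ^ (4 * n + 1)) * (1 - q ^ (6 * n + 3))
        / (1 + q ^ (2 * n + 1)) ^ 3) := by
  have h₁ : 1 - q ^ (2 * n + 1) ≠ 0 := one_sub_pow_ne_zero hq0 hq1 (by omega)
  have h₂ : 1 + q ^ (2 * n + 1) ≠ 0 := by positivity
  have h₃ : 1 - q ^ (2 * n + 2) ≠ 0 := one_sub_pow_ne_zero hq0 hq1 (by omega)
  have hsq : 1 - q ^ (4 * n + 2) = (1 - q ^ (2 * n + 1)) * (1 + q ^ (2 * n + 1)) := by ring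
  rw [symmH, symmWeight_comm, symmWeight_succ_left hq0 hq1]
  simp only [add_zero, mul_zero, show 2 * (n + n) + 2 = 4 * n + 2 by ring, hsq,
    show 2 * (n + n) + 1 = 4 * n + 1 by ring, show 2 * (n + 1) = 2 * n + 2 by ring,
    show 4 * n + (2 * n + 2) + 1 = 6 * n + 3 by ring]
  generalize 1 - q ^ (2 * n + 1) = a at *
  generalize 1 + q ^ (2 * n + 1) = b at *
  generalize 1 - q ^ (2 * n + 2) = c at *
  field_simp

theorem symmH_self_add_symmH_succ (hq0 : 0 ≤ q) (hq1 : q < 1) (n : ℕ) :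
    symmH q n n 0 + symmH q n (n + 1) 0 = S₃ q n := by
  have h : 1 + q ^ (2 * n + 1) ≠ 0 := by positivity
  have hv₁ := qPoch_sq_ne_zero hq0 hq1 n
  have hv₂ := qPoch_sq_ne_zero hq0 hq1 (2 * n)
  rw [S₃, P₂_eq, symmH_self_succ_zero hq0 hq1, symmH, symmWeight]
  simp only [add_zero, mul_zero, qPoch_zero, ← two_mul n,
    show 4 * n + 2 * n + 1 = 6 * n + 1 by ring, show 2 * n * n = 2 * n ^ 2 by ring,
    add_comm _ (1 : ℝ)]
  field_simp

theorem hasSum_S₃ (hq0 : 0 ≤ q) (hq1 : q < 1) :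
    HasSum (S₃ q) ((qPochInf q (q ^ 2) / qPochInf (q ^ 2) (q ^ 2)) ^ 4) := by
  have hH (n m k : ℕ) (hm : m ≠ 0) :=
    (abs_symmH_le hq0 hq1.le n m k).trans (abs_symmWeight_le hq0 hq1 n k hm)
  have hH₀₁ : Tendsto (symmH q 0 1) atTop (𝓝 0) :=
    squeeze_zero_norm (hH 0 1 · one_ne_zero) (tendsto_const_mul_pow_add hq0 hq1 _ 0)
  have hsum := (IsWZPair.of_symm (symmF_comm q) (isWZPair_symm hq0 hq1)).hasSum hq0 hq1
    (symmF_zero_zero q)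
    (fun n k hn => (abs_symmF_le hq0 hq1.le n n k).trans (abs_symmWeight_le hq0 hq1 n k hn))
    (by simpa only [add_zero, zero_add] using (tendsto_symmH_zero_zero hq0 hq1).add hH₀₁)
    fun n k hn => (norm_add_le_of_le (hH n n k hn) (hH n (n + 1) k n.succ_ne_zero)).trans_eq
      (add_mul _ _ _).symm
  simpa only [symmH_self_add_symmH_succ hq0 hq1] using hsum

end SecondSeed

/-! ### Termwise limits -/

section TermwiseLimits

/-- The `q`-number `[e]_q = 1 + q + ⋯ + q ^ (e - 1)`, by which `1 - q ^ e` vanishes to first order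
at `q = 1`. -/
def qNumber (q : ℝ) (e : ℕ) : ℝ := ∑ i ∈ Finset.range e, q ^ i

/-- The product of the `q`-numbers of `a, a + b, …, a + (n - 1) b`, which is what remains of the
`q`-shifted factorial `(q ^ a; q ^ b)_n` after removing the powers of `1 - q`. -/
def qNumberProd (q : ℝ) (a b n : ℕ) : ℝ := ∏ k ∈ Finset.range n, qNumber q (a + b * k)

theorem one_sub_pow_eq (q : ℝ) (e : ℕ) : 1 - q ^ e = (1 - q) * qNumber q e :=
  (mul_neg_geom_sum q e).symm

theorem qNumber_one (e : ℕ) : qNumber 1 e = e := by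
  simp [qNumber]

theorem qPoch_pow_eq (q : ℝ) (a b n : ℕ) :
    qPoch (q ^ a) (q ^ b) n = (1 - q) ^ n * qNumberProd q a b n := by
  simp only [qPoch, qNumberProd, ← pow_mul, ← pow_add, one_sub_pow_eq, Finset.prod_mul_distrib,
    Finset.prod_const, Finset.card_range]

theorem qPoch_odd_eq (q : ℝ) (n : ℕ) :
    qPoch q (q ^ 2) n = (1 - q) ^ n * qNumberProd q 1 2 n := by
  simpa only [pow_one] using qPoch_pow_eq q 1 2 n

@[fun_prop]
theorem continuous_qNumber (e : ℕ) : Continuous fun q => qNumber q e := by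
  unfold qNumber
  fun_prop

@[fun_prop]
theorem continuous_qNumberProd (a b n : ℕ) : Continuous fun q => qNumberProd q a b n := by
  unfold qNumberProd
  fun_prop

theorem poch_zero (a : ℝ) : poch a 0 = 1 := by
  simp [poch]

theorem poch_succ (a : ℝ) (n : ℕ) : poch a (n + 1) = poch a n * (a + n) :=
  ascPochhammer_succ_eval n a

theorem poch_pos {a : ℝ} (ha : 0 < a) (n : ℕ) : 0 < poch a n :=
  ascPochhammer_pos n a ha

theorem poch_two_mul (a : ℝ) (n : ℕ) :
    poch a (2 * n) = 2 ^ (2 * n) * (poch (a / 2) n * poch ((a + 1) / 2) n) := by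
  induction n with
  | zero => simp [poch_zero]
  | succ n ih =>
    rw [mul_add_one, poch_succ, poch_succ, ih, poch_succ, poch_succ]
    push_cast
    ring

theorem poch_one_two_mul (n : ℕ) : poch 1 (2 * n) = 2 ^ (2 * n) * (poch (1 / 2) n * poch 1 n) := by
  simpa [one_add_one_eq_two] using poch_two_mul 1 n

theorem poch_half_two_mul (n : ℕ) :
    poch (1 / 2) (2 * n) = 2 ^ (2 * n) * (poch (1 / 4) n * poch (3 / 4) n) := by
  convert! poch_two_mul (1 / 2) n using 4 <;> norm_num

theorem qNumberProd_one (a : ℕ) {b : ℕ} (hb : b ≠ 0) (n : ℕ) :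
    qNumberProd 1 a b n = b ^ n * poch (a / b) n := by
  induction n with
  | zero => simp [qNumberProd, poch_zero]
  | succ n ih =>
    rw [qNumberProd, Finset.prod_range_succ, ← qNumberProd, ih, qNumber_one, poch_succ]
    push_cast
    field_simp
    ring

theorem qNumberProd_one_odd (n : ℕ) : qNumberProd 1 1 2 n = 2 ^ n * poch (1 / 2) n := by
  exact_mod_cast qNumberProd_one 1 two_ne_zero n

theorem qNumberProd_one_even (n : ℕ) : qNumberProd 1 2 2 n = 2 ^ n * poch 1 n := by
  simpa using qNumberProd_one 2 two_ne_zero n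

theorem qNumberProd_one_even_ne_zero (n : ℕ) : qNumberProd 1 2 2 n ≠ 0 := by
  rw [qNumberProd_one_even]
  exact mul_ne_zero (by positivity) (poch_pos one_pos n).ne'

theorem tendsto_nhdsNE_of_eq {X Y : Type*} [TopologicalSpace X] [TopologicalSpace Y] {f g : X → Y}
    {a : X} {l : Y} (h : ∀ x, x ≠ a → f x = g x) (hg : ContinuousAt g a) (hl : g a = l) :
    Tendsto f (𝓝[≠] a) (𝓝 l) :=
  tendsto_nhdsWithin_congr (fun x hx => (h x hx).symm)
    (hl ▸ hg.tendsto.mono_left nhdsWithin_le_nhds)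

theorem tendsto_S₁ (n : ℕ) :
    Tendsto (fun q : ℝ => 8 * (S₁ q n / (1 - q ^ 2) ^ 2)) (𝓝[≠] 1) (𝓝 (R₁ n)) := by
  refine tendsto_nhdsNE_of_eq (g := fun q => 8 * ((-1) ^ n * q ^ (n ^ 2)
      * (qNumber q (4 * n + 1) ^ 2 + q ^ (2 * n + 1) * qNumber q (2 * n) ^ 2)
      * qNumberProd q 1 2 n ^ 6 / ((q ^ (2 * n + 1) + 1) * qNumberProd q 2 2 (2 * n)
        * qNumberProd q 2 2 n ^ 4 * qNumber q 2 ^ 2))) (fun q hq => ?_) ?_ ?_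
  · simp only [S₁, S₁_polynomial_eq, qPoch_odd_eq, qPoch_pow_eq, one_sub_pow_eq, div_div]
    refine congrArg _ (Eq.trans ?_
      (mul_div_mul_right _ _ (pow_ne_zero (6 * n + 2) (sub_ne_zero.2 hq.symm))))
    congr 1 <;> ring
  · refine continuousAt_const.mul (ContinuousAt.div (by fun_prop) (by fun_prop) ?_)
    simp [qNumber_one, qNumberProd_one_even_ne_zero]
  · have hhalf := (poch_pos one_half_pos n).ne'
    have hone := (poch_pos one_pos n).ne'
    simp only [qNumber_one, qNumberProd_one_odd, qNumberProd_one_even, poch_one_two_mul, R₁,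
      one_pow]
    push_cast
    field_simp
    ring

theorem tendsto_S₂ (n : ℕ) :
    Tendsto (fun q : ℝ => 128 * (S₂ q n / (1 - q ^ 2) ^ 2)) (𝓝[≠] 1) (𝓝 (R₂ n)) := by
  refine tendsto_nhdsNE_of_eq (g := fun q => 128 * ((-1) ^ n * q ^ (5 * n ^ 2)
      * ((1 + q ^ (2 * n + 1)) ^ 4
          * (qNumber q (6 * n + 1) ^ 2 + q ^ (2 * n + 1) * qNumber q (4 * n) ^ 2)
        - q ^ (6 * n + 1) * qNumber q (2 * n + 1) * qNumber q (6 * n + 3))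
      * qNumberProd q 1 2 n ^ 10 / ((q ^ (2 * n + 1) + 1) ^ 5 * qNumberProd q 2 2 (2 * n) ^ 5
        * qNumber q 2 ^ 2))) (fun q hq => ?_) ?_ ?_
  · simp only [S₂, P₁_eq, qPoch_odd_eq, qPoch_pow_eq, one_sub_pow_eq, div_div]
    refine congrArg _ (Eq.trans ?_
      (mul_div_mul_right _ _ (pow_ne_zero (10 * n + 2) (sub_ne_zero.2 hq.symm))))
    congr 1 <;> ring
  · refine continuousAt_const.mul (ContinuousAt.div (by fun_prop) (by fun_prop) ?_)
    simp [qNumber_one, qNumberProd_one_even_ne_zero]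
  · have hhalf := (poch_pos one_half_pos n).ne'
    have hone := (poch_pos one_pos n).ne'
    simp only [qNumber_one, qNumberProd_one_odd, qNumberProd_one_even, poch_one_two_mul, R₂,
      one_pow]
    push_cast
    field_simp
    ring

theorem tendsto_S₃ (n : ℕ) :
    Tendsto (fun q : ℝ => 32 * (S₃ q n / (1 - q ^ 2) ^ 2)) (𝓝[≠] 1) (𝓝 (R₃ n)) := by
  refine tendsto_nhdsNE_of_eq (g := fun q => 32 * (q ^ (2 * n ^ 2)
      * ((1 + q ^ (2 * n + 1)) ^ 3 * (qNumber q (2 * n) * qNumber q (6 * n + 1))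
        + q ^ (2 * n) * qNumber q (4 * n + 1) * qNumber q (6 * n + 3))
      * qNumberProd q 1 2 (2 * n) * qNumberProd q 1 2 n ^ 6
      / ((q ^ (2 * n + 1) + 1) ^ 3 * qNumberProd q 2 2 n ^ 2 * qNumberProd q 2 2 (2 * n) ^ 3
        * qNumber q 2 ^ 2))) (fun q hq => ?_) ?_ ?_
  · simp only [S₃, P₂_eq, qPoch_odd_eq, qPoch_pow_eq, one_sub_pow_eq, div_div]
    refine congrArg _ (Eq.trans ?_
      (mul_div_mul_right _ _ (pow_ne_zero (8 * n + 2) (sub_ne_zero.2 hq.symm))))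
    congr 1 <;> ring
  · refine continuousAt_const.mul (ContinuousAt.div (by fun_prop) (by fun_prop) ?_)
    simp [qNumber_one, qNumberProd_one_even_ne_zero]
  · have hhalf := (poch_pos one_half_pos n).ne'
    have hone := (poch_pos one_pos n).ne'
    simp only [qNumber_one, qNumberProd_one_odd, qNumberProd_one_even, poch_one_two_mul,
      poch_half_two_mul, R₃, one_pow, one_div_pow, ← pow_mul]
    push_cast
    field_simp
    ring

end TermwiseLimits

/-! ### The limit of the `q`-gamma function at one half -/

section GammaLimit

variable {q : ℝ}

/-- The excess over `1` of the `m`-th factor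
`[2 * m + 2]_q ^ 2 / ([2 * m + 1]_q * [2 * m + 3]_q)` of a `q`-analogue of the Wallis product. -/
def qWallisExcess (q : ℝ) (m : ℕ) : ℝ :=
  q ^ (2 * m + 1) / (qNumber q (2 * m + 1) * qNumber q (2 * m + 3))

theorem qNumber_succ (q : ℝ) (e : ℕ) : qNumber q (e + 1) = qNumber q e + q ^ e :=
  Finset.sum_range_succ _ _

theorem qNumber_succ' (q : ℝ) (e : ℕ) : qNumber q (e + 1) = q * qNumber q e + 1 :=
  geom_sum_succ

theorem qNumber_pos (hq : 0 ≤ q) {e : ℕ} (he : e ≠ 0) : 0 < qNumber q e :=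
  geom_sum_pos hq he

theorem qNumber_succ_sq (q : ℝ) (e : ℕ) :
    qNumber q (e + 1) ^ 2 = qNumber q e * qNumber q (e + 2) + q ^ e := by
  have hleft := qNumber_succ' q e
  have hright := qNumber_succ q (e + 1)
  have hmid := qNumber_succ q e
  linear_combination qNumber q (e + 1) * hmid - qNumber q e * hright + q ^ e * hleft

-- Pairing `q ^ (m - j)` with `q ^ (m + j)`, this is the AM–GM inequality.
theorem mul_pow_le_qNumber (hq : 0 ≤ q) (m : ℕ) :
    (2 * m + 1) * q ^ m ≤ qNumber q (2 * m + 1) := by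
  induction m with
  | zero => simp [qNumber]
  | succ m ih =>
    have hamgm : 2 * q ^ (m + 1) ≤ 1 + q ^ (2 * m + 2) := by
      linear_combination sq_nonneg (1 - q ^ (m + 1))
    rw [mul_add_one, qNumber_succ, qNumber_succ']
    push_cast
    linear_combination q * ih + hamgm

theorem qWallisExcess_nonneg (hq : 0 ≤ q) (m : ℕ) : 0 ≤ qWallisExcess q m :=
  div_nonneg (pow_nonneg hq _)
    (mul_pos (qNumber_pos hq (2 * m).succ_ne_zero) (qNumber_pos hq (2 * m + 2).succ_ne_zero)).le

theorem qWallisExcess_one (m : ℕ) : qWallisExcess 1 m = 1 / ((2 * m + 1) * (2 * m + 3)) := by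
  simp [qWallisExcess, qNumber_one]

theorem qWallisExcess_le (hq : 0 ≤ q) (m : ℕ) : qWallisExcess q m ≤ qWallisExcess 1 m := by
  have hpos := mul_pos (qNumber_pos hq (2 * m).succ_ne_zero)
    (qNumber_pos hq (2 * m + 2).succ_ne_zero)
  rw [qWallisExcess_one, qWallisExcess, div_le_div_iff₀ hpos (by positivity), one_mul]
  calc q ^ (2 * m + 1) * ((2 * m + 1) * (2 * m + 3))
      = ((2 * m + 1) * q ^ m) * ((2 * (m + 1 : ℕ) + 1) * q ^ (m + 1)) := by
        push_cast
        ring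
    _ ≤ qNumber q (2 * m + 1) * qNumber q (2 * m + 3) :=
        mul_le_mul (mul_pow_le_qNumber hq m) (mul_pow_le_qNumber hq (m + 1)) (by positivity)
          (qNumber_pos hq (2 * m).succ_ne_zero).le

theorem summable_qWallisExcess_one : Summable (qWallisExcess 1) := by
  refine ((summable_nat_add_iff 1).2 (Real.summable_one_div_nat_pow.2 one_lt_two)).of_nonneg_of_le
    (qWallisExcess_nonneg zero_le_one) fun m => ?_
  rw [qWallisExcess_one]
  push_cast
  gcongr
  nlinarith

theorem tendsto_prod_one_add_qWallisExcess (hq : 0 ≤ q) :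
    Tendsto (fun N => ∏ m ∈ Finset.range N, (1 + qWallisExcess q m)) atTop
      (𝓝 (∏' m, (1 + qWallisExcess q m))) := by
  refine (multipliable_one_add_of_summable ?_).hasProd.tendsto_prod_nat
  simpa only [Real.norm_of_nonneg (qWallisExcess_nonneg hq _)] using
    summable_qWallisExcess_one.of_nonneg_of_le (qWallisExcess_nonneg hq) (qWallisExcess_le hq)

theorem tprod_one_add_qWallisExcess_one : ∏' m, (1 + qWallisExcess 1 m) = Real.pi / 2 := by
  refine tendsto_nhds_unique (tendsto_prod_one_add_qWallisExcess zero_le_one) ?_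
  refine Real.tendsto_prod_pi_div_two.congr fun N => Finset.prod_congr rfl fun m _ => ?_
  rw [qWallisExcess_one]
  field_simp
  ring

theorem continuousAt_tprod_one_add_qWallisExcess :
    ContinuousAt (fun q => ∏' m, (1 + qWallisExcess q m)) 1 := by
  refine tendsto_tprod_one_add_of_dominated_convergence summable_qWallisExcess_one (fun m => ?_) ?_
  · refine ContinuousAt.div (by fun_prop) (by fun_prop) ?_
    exact (mul_pos (qNumber_pos zero_le_one (2 * m).succ_ne_zero)
      (qNumber_pos zero_le_one (2 * m + 2).succ_ne_zero)).ne'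
  · filter_upwards [lt_mem_nhds one_pos] with q hq m
    rw [Real.norm_of_nonneg (qWallisExcess_nonneg hq.le m)]
    exact qWallisExcess_le hq.le m

theorem prod_one_add_qWallisExcess (hq0 : 0 ≤ q) (hq1 : q < 1) (N : ℕ) :
    ∏ m ∈ Finset.range N, (1 + qWallisExcess q m)
      = (1 - q)
        * (qPoch (q ^ 2) (q ^ 2) N ^ 2 / (qPoch q (q ^ 2) N * qPoch q (q ^ 2) (N + 1))) := by
  have hsub : 1 - q ≠ 0 := (sub_pos.2 hq1).ne'
  induction N with
  | zero => simp [qPoch, hsub]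
  | succ N ih =>
    have hu₁ := (qPoch_pos hq1 (sq_nonneg q) (pow_le_one₀ hq0 hq1.le) N).ne'
    have h₁ := (qNumber_pos hq0 (2 * N).succ_ne_zero).ne'
    have h₃ := (qNumber_pos hq0 (2 * N + 2).succ_ne_zero).ne'
    have hfactor : 1 + qWallisExcess q N
        = qNumber q (2 * N + 2) ^ 2 / (qNumber q (2 * N + 1) * qNumber q (2 * N + 3)) := by
      rw [qNumber_succ_sq, qWallisExcess]
      field_simp
    rw [Finset.prod_range_succ, ih, hfactor]
    simp only [qPoch_odd_succ, qPoch_even_succ, mul_add_one, add_assoc, Nat.reduceAdd,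
      one_sub_pow_eq]
    field_simp

theorem qGamma_half_sq (hq0 : 0 ≤ q) (hq1 : q < 1) :
    qGamma (q ^ 2) (1 / 2) ^ 2
      = (1 - q ^ 2) * (qPochInf (q ^ 2) (q ^ 2) / qPochInf q (q ^ 2)) ^ 2 := by
  have hroot : (q ^ 2) ^ (1 / 2 : ℝ) = q := by rw [← Real.sqrt_eq_rpow, Real.sqrt_sq hq0]
  have hsub : 0 ≤ 1 - q ^ 2 := sub_nonneg.2 (pow_le_one₀ hq0 hq1.le)
  rw [qGamma, hroot, sub_half, mul_pow, ← Real.sqrt_eq_rpow, Real.sq_sqrt hsub]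

theorem sq_div_qGamma_half_pow (hq0 : 0 ≤ q) (hq1 : q < 1) :
    (1 - q ^ 2) ^ 2 / qGamma (q ^ 2) (1 / 2) ^ 4
      = (qPochInf q (q ^ 2) / qPochInf (q ^ 2) (q ^ 2)) ^ 4 := by
  have hsub : 1 - q ^ 2 ≠ 0 := one_sub_pow_ne_zero hq0 hq1 two_ne_zero
  calc (1 - q ^ 2) ^ 2 / qGamma (q ^ 2) (1 / 2) ^ 4
      = ((1 - q ^ 2) / qGamma (q ^ 2) (1 / 2) ^ 2) ^ 2 := by ring
    _ = ((qPochInf (q ^ 2) (q ^ 2) / qPochInf q (q ^ 2)) ^ 2)⁻¹ ^ 2 := by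
        rw [qGamma_half_sq hq0 hq1, div_mul_cancel_left₀ hsub]
    _ = (qPochInf q (q ^ 2) / qPochInf (q ^ 2) (q ^ 2)) ^ 4 := by
        rw [← inv_pow, inv_div, ← pow_mul]

theorem qGamma_half_sq_eq_tprod (hq0 : 0 ≤ q) (hq1 : q < 1) :
    qGamma (q ^ 2) (1 / 2) ^ 2 = (1 + q) * ∏' m, (1 + qWallisExcess q m) := by
  have hp0 := sq_nonneg q
  have hp1 : q ^ 2 < 1 := pow_lt_one₀ hq0 hq1 two_ne_zero
  have hU := (qPochInf_pos hq1 hp0 hp1).ne'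
  have hu := tendsto_qPoch hp0 hp1 q
  have hprod := (((tendsto_qPoch hp0 hp1 (q ^ 2)).pow 2).div
    (hu.mul ((tendsto_add_atTop_iff_nat 1).2 hu)) (mul_ne_zero hU hU)).const_mul (1 - q)
  rw [tendsto_nhds_unique (tendsto_prod_one_add_qWallisExcess hq0)
    (hprod.congr fun N => (prod_one_add_qWallisExcess hq0 hq1 N).symm), qGamma_half_sq hq0 hq1]
  ring

theorem tendsto_qGamma_half_sq :
    Tendsto (fun q : ℝ => qGamma (q ^ 2) (1 / 2) ^ 2) (𝓝[<] 1) (𝓝 Real.pi) := by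
  have hlim : Tendsto (fun q => (1 + q) * ∏' m, (1 + qWallisExcess q m)) (𝓝[<] 1) (𝓝 Real.pi) := by
    convert! ((continuousAt_const.add continuousAt_id).mul
      continuousAt_tprod_one_add_qWallisExcess).tendsto.mono_left nhdsWithin_le_nhds using 2
    simp only [Pi.mul_apply, Pi.add_apply, id, tprod_one_add_qWallisExcess_one]
    ring
  refine hlim.congr' ?_
  filter_upwards [Ioo_mem_nhdsLT (zero_lt_one' ℝ)] with q hq
  exact (qGamma_half_sq_eq_tprod hq.1.le hq.2).symm

theorem tendsto_inv_qGamma_half (c : ℝ) :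
    Tendsto (fun q : ℝ => c * (1 / qGamma (q ^ 2) (1 / 2) ^ 4)) (𝓝[<] 1)
      (𝓝 (c / Real.pi ^ 2)) := by
  convert! ((tendsto_qGamma_half_sq.pow 2).inv₀ (pow_ne_zero 2 Real.pi_ne_zero)).const_mul c using 2
  rw [← pow_mul, one_div]

end GammaLimit

end QRamanujan

end

theorem mainTheorem3 :
    (∀ q : ℝ, 0 < q → q < 1 →
      HasSum (QRamanujan.S₁ q) ((1 - q ^ 2) ^ 2 / QRamanujan.qGamma (q ^ 2) (1 / 2) ^ 4) ∧
      HasSum (QRamanujan.S₂ q) ((1 - q ^ 2) ^ 2 / QRamanujan.qGamma (q ^ 2) (1 / 2) ^ 4) ∧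
      HasSum (QRamanujan.S₃ q) ((1 - q ^ 2) ^ 2 / QRamanujan.qGamma (q ^ 2) (1 / 2) ^ 4)) ∧
    (∀ n : ℕ,
      Tendsto (fun q : ℝ => 8 * (QRamanujan.S₁ q n / (1 - q ^ 2) ^ 2))
        (𝓝[<] 1) (𝓝 (QRamanujan.R₁ n)) ∧
      Tendsto (fun q : ℝ => 128 * (QRamanujan.S₂ q n / (1 - q ^ 2) ^ 2))
        (𝓝[<] 1) (𝓝 (QRamanujan.R₂ n)) ∧
      Tendsto (fun q : ℝ => 32 * (QRamanujan.S₃ q n / (1 - q ^ 2) ^ 2))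
        (𝓝[<] 1) (𝓝 (QRamanujan.R₃ n))) ∧
    Tendsto (fun q : ℝ => 8 * (1 / QRamanujan.qGamma (q ^ 2) (1 / 2) ^ 4))
      (𝓝[<] 1) (𝓝 (8 / Real.pi ^ 2)) ∧
    Tendsto (fun q : ℝ => 128 * (1 / QRamanujan.qGamma (q ^ 2) (1 / 2) ^ 4))
      (𝓝[<] 1) (𝓝 (128 / Real.pi ^ 2)) ∧
    Tendsto (fun q : ℝ => 32 * (1 / QRamanujan.qGamma (q ^ 2) (1 / 2) ^ 4))
      (𝓝[<] 1) (𝓝 (32 / Real.pi ^ 2)) :=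
  ⟨fun q hq0 hq1 => by
      rw [QRamanujan.sq_div_qGamma_half_pow hq0.le hq1]
      exact ⟨QRamanujan.hasSum_S₁ hq0.le hq1, QRamanujan.hasSum_S₂ hq0.le hq1,
        QRamanujan.hasSum_S₃ hq0.le hq1⟩,
    fun n => ⟨(QRamanujan.tendsto_S₁ n).mono_left (nhdsLT_le_nhdsNE 1),
      (QRamanujan.tendsto_S₂ n).mono_left (nhdsLT_le_nhdsNE 1),
      (QRamanujan.tendsto_S₃ n).mono_left (nhdsLT_le_nhdsNE 1)⟩,
    QRamanujan.tendsto_inv_qGamma_half 8, QRamanujan.tendsto_inv_qGamma_half 128,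
    QRamanujan.tendsto_inv_qGamma_half 32⟩
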